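/- All topological groups and vector spaces are Hausdorff, and locally convex spaces are over $\mathbb R$. A map $f:U\to F$ from an open subset $U$ of a locally convex space $E$ to a locally convex space $F$ is smooth if for all $j\ge 0$ the iterated directional derivatives $(\partial_{h_j}\cdots\partial_{h_1}f)(x)$ exist for all $x\in U$, $h_1,\dots,h_j\in E$ and are continuous as functions of $(x,h_1,\dots,h_j)\in U\times E^j$. A (locally convex) Lie group is a group $G$ with a smooth manifold structure modelled on a locally convex space, in the sense of these smooth maps, whose multiplication and inversion are smooth; $L(G)=T_{\mathbf 1}(G)$. An exponential function of $G$ is a smooth map $\exp_G:L(G)\to G$ such that for every $x\in L(G)$ the curve $\gamma_x(t):=\exp_G(tx)$ is a one-parameter group with $\gamma_x'(0)=x$. The group $G$ has the Trotter property if it has an exponential function $\exp_G$ and, for all $x_1,x_2\in L(G)$, $$\exp_G(t(x_1+x_2))=\lim_{n\to\infty}\Big(\exp_G\big(\tfrac tn x_1\big)\exp_G\big(\tfrac tn x_2\big)\Big)^n$$ uniformly for $t$ in compact subsets of $\mathbb R$; here a sequence $\gamma_n:S\to G$ converges uniformly to $\gamma:S\to G$ if for every neighbourhood $U$ of $\mathbf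 1$ in $G$ there is $N\ge 1$ with $\gamma_n(s)\in\gamma(s)U$ for all $s\in S$ and $n\ge N$. **Theorem.** Let $G$ be a locally convex Lie group with the Trotter property, let $V$ be a locally convex space, and let $\phi:G\to V$ be continuous. Suppose that for every $x\in L(G)$ the derivative $$(D_x\phi)(g)=\lim_{t\to 0}\frac{\phi(g\exp_G(tx))-\phi(g)}{t}$$ exists for every $g\in G$ and that the function $D_x\phi:G\to V$ is continuous. Then the map $$L(G)\to C(G,V),\qquad x\mapsto D_x\phi,$$ is linear over $\mathbb R$, where $C(G,V)$ is the vector space of continuous maps $G\to V$. -/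

import Mathlib

open Filter Topology

namespace LCLie

/-! ## Smooth maps between locally convex spaces -/

section Calculus

variable {E F : Type*} [AddCommGroup E] [Module ℝ E] [TopologicalSpace E]
  [AddCommGroup F] [Module ℝ F] [TopologicalSpace F]

/-- `v` is the derivative of `f` at `x` in the direction `h`, that is,
`v = lim_{t → 0} (f (x + t h) - f x) / t`. -/
def HasDirDerivAt (f : E → F) (x h : E) (v : F) : Prop :=
  Tendsto (fun t : ℝ => t⁻¹ • (f (x + t • h) - f x)) (𝓝[≠] 0) (𝓝 v)

/-- `f` is smooth on the open set `U`: for every `j` the iterated directional derivatives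
`d j x (h₁, …, h_j) = (∂_{h_j} ⋯ ∂_{h_1} f)(x)` exist for all `x ∈ U`, and `d j` is continuous on
`U × E ^ j`.  (For `j = 0` this says that `f` is continuous on `U`.) -/
def IsSmoothOn (f : E → F) (U : Set E) : Prop :=
  ∃ d : (j : ℕ) → E → (Fin j → E) → F,
    (∀ x ∈ U, ∀ h : Fin 0 → E, d 0 x h = f x) ∧
    (∀ (j : ℕ), ∀ x ∈ U, ∀ (h : Fin j → E) (k : E),
      HasDirDerivAt (fun y => d j y h) x k (d (j + 1) x (Fin.snoc h k))) ∧
    (∀ j : ℕ, ContinuousOn (fun p : E × (Fin j → E) => d j p.1 p.2) (U ×ˢ Set.univ))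

end Calculus

/-! ## Manifolds and Lie groups modelled on a locally convex space -/

section Manifolds

variable (E F : Type*) [AddCommGroup E] [Module ℝ E] [TopologicalSpace E]
  [AddCommGroup F] [Module ℝ F] [TopologicalSpace F]

/-- The atlas of `M` has smooth chart changes. -/
def IsSmoothManifold (M : Type*) [TopologicalSpace M] [ChartedSpace E M] : Prop :=
  ∀ e ∈ atlas E M, ∀ e' ∈ atlas E M,
    IsSmoothOn (fun x => e' (e.symm x)) (e.target ∩ e.symm ⁻¹' e'.source)

/-- A map between manifolds is smooth if it is continuous and smooth in all charts. -/
structure IsSmoothMap {M N : Type*} [TopologicalSpace M] [ChartedSpace E M]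
    [TopologicalSpace N] [ChartedSpace F N] (f : M → N) : Prop where
  continuous : Continuous f
  smooth_charts : ∀ e ∈ atlas E M, ∀ e' ∈ atlas F N,
    IsSmoothOn (fun x => e' (f (e.symm x))) (e.target ∩ e.symm ⁻¹' (f ⁻¹' e'.source))

/-- The product manifold structure on `M × N`, given by the products of charts. -/
@[reducible] def prodManifold (M N : Type*) [TopologicalSpace M] [ChartedSpace E M]
    [TopologicalSpace N] [ChartedSpace F N] : ChartedSpace (E × F) (M × N) :=
  prodChartedSpace E M F N

/-- A group with a smooth manifold structure modelled on the locally convex space `E` for which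
multiplication and inversion are smooth. -/
structure IsLieGroup (G : Type*) [Group G] [TopologicalSpace G] [ChartedSpace E G] : Prop where
  smooth_manifold : IsSmoothManifold E G
  smooth_mul : letI := prodManifold E E G G
    IsSmoothMap (E × E) E (fun p : G × G => p.1 * p.2)
  smooth_inv : IsSmoothMap E E (fun g : G => g⁻¹)

/-- The underlying locally convex space of the Lie algebra `L(G) = T_1(G)`.  As for Mathlib's
`TangentSpace`, the tangent space at `1` is identified with the model space `E` through the
preferred chart at `1`. -/
abbrev LieAlg (G : Type*) [Group G] [TopologicalSpace G] [ChartedSpace E G] : Type _ := E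

variable {E}

/-- The curve `γ : ℝ → G` with `γ 0 = 1` has velocity `x ∈ T_1(G)` at `t = 0`. -/
def HasVelocityAtOne {G : Type*} [Group G] [TopologicalSpace G] [ChartedSpace E G]
    (γ : ℝ → G) (x : LieAlg E G) : Prop :=
  γ 0 = 1 ∧
    Tendsto (fun t : ℝ => t⁻¹ • (chartAt E (1 : G) (γ t) - chartAt E (1 : G) (γ 0)))
      (𝓝[≠] 0) (𝓝 x)

/-- `exp : L(G) → G` is an exponential function: it is smooth and every curve `t ↦ exp (t x)` is a
one-parameter group with velocity `x` at `0`. -/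
structure IsExponentialFunction {G : Type*} [Group G] [TopologicalSpace G] [ChartedSpace E G]
    (exp : LieAlg E G → G) : Prop where
  smooth : IsSmoothMap E E exp
  map_add : ∀ (x : LieAlg E G) (s t : ℝ), exp ((s + t) • x) = exp (s • x) * exp (t • x)
  velocity : ∀ x : LieAlg E G, HasVelocityAtOne (fun t : ℝ => exp (t • x)) x

end Manifolds

/-! ## The Trotter property and right derivatives -/

section Trotter

/-- Uniform convergence on `S ⊆ ℝ` of a sequence of maps into a topological group. -/
def UniformlyConvergentOn {G : Type*} [Group G] [TopologicalSpace G]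
    (γs : ℕ → ℝ → G) (γ : ℝ → G) (S : Set ℝ) : Prop :=
  ∀ U ∈ 𝓝 (1 : G), ∃ N : ℕ, 1 ≤ N ∧ ∀ n ≥ N, ∀ s ∈ S, ∃ u ∈ U, γs n s = γ s * u

/-- `X = X₁ + X₂` for one-parameter groups: `X(t) = lim_{n → ∞} (X₁(t/n) X₂(t/n)) ^ n`, uniformly
in `t` on compact subsets of `ℝ`. -/
def IsTrotterSum {G : Type*} [Group G] [TopologicalSpace G] (X X₁ X₂ : ℝ → G) : Prop :=
  ∀ K : Set ℝ, IsCompact K →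
    UniformlyConvergentOn (fun n t => (X₁ (t / n) * X₂ (t / n)) ^ n) X K

variable {E : Type*} [AddCommGroup E] [Module ℝ E] [TopologicalSpace E]

/-- The Lie group `G` has the Trotter property with exponential function `exp`: `exp` is a smooth
exponential function and `γ_{x₁ + x₂} = γ_{x₁} + γ_{x₂}` for all `x₁, x₂ ∈ L(G)`, where
`γ_x t = exp (t x)`. -/
structure HasTrotterProperty {G : Type*} [Group G] [TopologicalSpace G] [ChartedSpace E G]
    (exp : LieAlg E G → G) : Prop where
  exponential : IsExponentialFunction exp
  trotter : ∀ x₁ x₂ : LieAlg E G,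
    IsTrotterSum (fun t : ℝ => exp (t • (x₁ + x₂))) (fun t : ℝ => exp (t • x₁))
      (fun t : ℝ => exp (t • x₂))

variable {G V : Type*} [Group G] [AddCommGroup V] [Module ℝ V] [TopologicalSpace V]

/-- The difference quotient `(φ (g X(t)) - φ g) / t`. -/
noncomputable def rightQuotient (φ : G → V) (X : ℝ → G) (g : G) (t : ℝ) : V :=
  t⁻¹ • (φ (g * X t) - φ g)

/-- The derivative `(D_X φ)(g)` exists. -/
def RightDerivExistsAt (φ : G → V) (X : ℝ → G) (g : G) : Prop :=
  ∃ v : V, Tendsto (rightQuotient φ X g) (𝓝[≠] 0) (𝓝 v)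

/-- `(D_X φ)(g) = lim_{t → 0} (φ (g X(t)) - φ g) / t` (meaningful when the limit exists). -/
noncomputable def rightDeriv (φ : G → V) (X : ℝ → G) (g : G) : V :=
  limUnder (𝓝[≠] (0 : ℝ)) (rightQuotient φ X g)

end Trotter

end LCLie

/-!
The content of the theorem is that `x ↦ D_x φ` is additive; homogeneity is a substitution in the
limit. Continuous linear functionals separate the points of `V`, so additivity may be checked for
real-valued `ψ = l ∘ φ`. Fix `g` and put `Xᵢ t = exp (t xᵢ)`, `X t = exp (t (x₁ + x₂))`,
`P s = X₁ s * X₂ s`.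

* Uniformity in the Trotter formula keeps every partial product `P (t / n) ^ k`, `k ≤ n`, near `1`
  once `t` is small (`IsTrotterSum.exists_pow_mem`): this power is the `k`-th approximant at
  parameter `k t / n`, which is close to `X (k t / n)` if `k` is large, and the finitely many
  remaining `k` are handled by continuity.
* Along a one-parameter group `ψ` is differentiable with derivative `D_X ψ`, so the mean value
  inequality compares each of the `2 n` increments of `ψ` along the product `g P (t / n) ^ n` with
  `t / n` times `D_X₁ ψ g` or `D_X₂ ψ g`. Since these derivatives are continuous, telescoping gives
  `|ψ (g P (t / n) ^ n) - ψ g - t (D_X₁ ψ g + D_X₂ ψ g)| ≤ ε |t|` for small `t` and all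
  `n ≥ 1`.

Letting `n → ∞` replaces `P (t / n) ^ n` by `X t` (`IsTrotterSum.abs_sub_sub_le`), and dividing by
`t` identifies `D_X ψ g` (`IsTrotterSum.tendsto_rightQuotient`).
-/

namespace LCLie

variable {G : Type*} [Group G]

/-- `HasRightDeriv ψ X d` says that `ψ` has the derivative `D_X ψ = d` at every point of `G`. -/
def HasRightDeriv {V : Type*} [AddCommGroup V] [Module ℝ V] [TopologicalSpace V]
    (ψ : G → V) (X : ℝ → G) (d : G → V) : Prop :=
  ∀ g, Tendsto (rightQuotient ψ X g) (𝓝[≠] 0) (𝓝 (d g))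

lemma HasRightDeriv.hasDerivAt {ψ : G → ℝ} {X : ℝ → G} {d : G → ℝ} (h : HasRightDeriv ψ X d)
    (hX : ∀ s t, X (s + t) = X s * X t) (g : G) (t : ℝ) :
    HasDerivAt (fun s => ψ (g * X s)) (d (g * X t)) t := by
  rw [hasDerivAt_iff_tendsto_slope_zero]
  refine (h (g * X t)).congr fun s => ?_
  simp only [rightQuotient, hX, mul_assoc]

/-- The mean value inequality along a one-parameter group. -/
lemma HasRightDeriv.abs_sub_sub_le {ψ : G → ℝ} {X : ℝ → G} {d : G → ℝ}
    (h : HasRightDeriv ψ X d) (hX : ∀ s t, X (s + t) = X s * X t) (h0 : X 0 = 1) {g : G}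
    {c ε t : ℝ} (hd : ∀ s, |s| ≤ |t| → |d (g * X s) - c| ≤ ε) :
    |ψ (g * X t) - ψ g - t * c| ≤ ε * |t| := by
  have key := (convex_Icc (-|t|) |t|).norm_image_sub_le_of_norm_hasDerivWithin_le
    (f := fun s => ψ (g * X s) - s * c) (f' := fun s => d (g * X s) - c) (C := ε)
    (x := 0) (y := t)
    (fun s _ => ((h.hasDerivAt hX g s).sub (hasDerivAt_mul_const c)).hasDerivWithinAt)
    (fun s hs => hd s (abs_le.2 hs)) (Set.mem_Icc.2 (by simp)) (abs_le.1 le_rfl)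
  simp only [Real.norm_eq_abs, h0, mul_one, zero_mul, sub_zero] at key
  rwa [sub_right_comm]

variable [TopologicalSpace G] [ContinuousMul G]

/-- The partial products in the Trotter formula stay near `1`, uniformly in `n`, for small `t`. -/
lemma IsTrotterSum.exists_pow_mem {X X₁ X₂ : ℝ → G} (hT : IsTrotterSum X X₁ X₂)
    (hX : Continuous X) (hX₁ : Continuous X₁) (hX₂ : Continuous X₂)
    (h0 : X 0 = 1) (h₁ : X₁ 0 = 1) (h₂ : X₂ 0 = 1) {U : Set G} (hU : U ∈ 𝓝 (1 : G)) :
    ∃ δ > 0, ∀ t : ℝ, |t| < δ → ∀ n k : ℕ, k ≤ n → (X₁ (t / n) * X₂ (t / n)) ^ k ∈ U := by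
  have hmul : Tendsto (fun p : G × G => p.1 * p.2) (𝓝 (1, 1)) (𝓝 1) := by
    simpa using (continuous_mul (M := G)).tendsto (1, 1)
  obtain ⟨A, hA, B, hB, hAB⟩ := mem_nhds_prod_iff.1 (hmul hU)
  obtain ⟨N, -, hN⟩ := hT (Set.Icc (-1) 1) isCompact_Icc B hB
  have hXA : ∀ᶠ s in 𝓝 (0 : ℝ), X s ∈ A := hX.tendsto' 0 1 h0 hA
  have hsmall : ∀ᶠ s in 𝓝 (0 : ℝ), ∀ k ∈ Finset.range N, (X₁ s * X₂ s) ^ k ∈ U := by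
    rw [Filter.eventually_all_finset]
    intro k _
    exact ((hX₁.mul hX₂).pow k).tendsto' 0 1 (by simp [h₁, h₂]) hU
  obtain ⟨δ, hδ, hball⟩ := Metric.eventually_nhds_iff.1 (hXA.and hsmall)
  simp only [Real.dist_eq, sub_zero] at hball
  refine ⟨min δ 1, by positivity, fun t ht n k hk => ?_⟩
  obtain rfl | hk0 := k.eq_zero_or_pos
  · simpa using mem_of_mem_nhds hU
  have hn : (1 : ℝ) ≤ n := by exact_mod_cast hk0.trans_le hk
  rw [lt_min_iff] at ht
  obtain hkN | hkN := lt_or_ge k N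
  · refine (hball ?_).2 k (Finset.mem_range.2 hkN)
    rw [abs_div, Nat.abs_cast]
    exact (div_le_self (abs_nonneg t) hn).trans_lt ht.1
  -- the power is the `k`-th Trotter approximant at parameter `k t / n`
  have hs : |k * (t / n)| ≤ |t| := by
    rw [abs_mul, abs_div, Nat.abs_cast, Nat.abs_cast, mul_div_left_comm]
    exact mul_le_of_le_one_right (abs_nonneg t)
      (div_le_one_of_le₀ (by exact_mod_cast hk) (by positivity))
  obtain ⟨u, hu, hue⟩ := hN k hkN (k * (t / n)) (abs_le.1 (hs.trans ht.2.le))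
  beta_reduce at hue
  rw [mul_div_cancel_left₀ _ (by exact_mod_cast hk0.ne')] at hue
  rw [hue]
  exact hAB (Set.mk_mem_prod (hball (hs.trans_lt ht.1)).1 hu)

lemma IsTrotterSum.tendsto {X X₁ X₂ : ℝ → G} (hT : IsTrotterSum X X₁ X₂) (t : ℝ) :
    Tendsto (fun n : ℕ => (X₁ (t / n) * X₂ (t / n)) ^ n) atTop (𝓝 (X t)) := by
  refine tendsto_def.2 fun U hU => ?_
  have hc : Tendsto (fun u => X t * u) (𝓝 1) (𝓝 (X t)) :=
    (continuous_const_mul (X t)).tendsto' 1 _ (mul_one _)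
  obtain ⟨N, -, hN⟩ := hT {t} isCompact_singleton _ (hc hU)
  filter_upwards [eventually_ge_atTop N] with n hn
  obtain ⟨u, hu, hue⟩ := hN n hn t rfl
  simpa only [Set.mem_preimage, hue] using hu

/-- A sequence with increments within `b` of `a` stays within `k b` of the corresponding
arithmetic progression. -/
lemma abs_sub_sub_nat_mul_le {u : ℕ → ℝ} {a b : ℝ} {n : ℕ}
    (h : ∀ k < n, |u (k + 1) - u k - a| ≤ b) : |u n - u 0 - n * a| ≤ n * b := by
  have hsum : u n - u 0 - n * a = ∑ k ∈ Finset.range n, (u (k + 1) - u k - a) := by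
    rw [Finset.sum_sub_distrib, Finset.sum_range_sub]
    simp
  rw [hsum]
  refine (Finset.abs_sum_le_sum_abs _ _).trans ((Finset.sum_le_sum fun k hk =>
    h k (Finset.mem_range.1 hk)).trans ?_)
  simp

variable {X X₁ X₂ : ℝ → G} {ψ d₁ d₂ : G → ℝ}

/-- `ψ (g X(t))` agrees with `ψ g + t (D_X₁ ψ g + D_X₂ ψ g)` up to `o(t)`. -/
lemma IsTrotterSum.abs_sub_sub_le (hT : IsTrotterSum X X₁ X₂)
    (hX : Continuous X) (hX₁ : Continuous X₁) (hX₂ : Continuous X₂)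
    (h0 : X 0 = 1) (h₁ : X₁ 0 = 1) (h₂ : X₂ 0 = 1)
    (hm₁ : ∀ s t, X₁ (s + t) = X₁ s * X₁ t) (hm₂ : ∀ s t, X₂ (s + t) = X₂ s * X₂ t)
    (hψ : Continuous ψ) (hd₁ : HasRightDeriv ψ X₁ d₁) (hd₂ : HasRightDeriv ψ X₂ d₂)
    (hc₁ : Continuous d₁) (hc₂ : Continuous d₂) (g : G) {ε : ℝ} (hε : 0 < ε) :
    ∀ᶠ t in 𝓝 (0 : ℝ), |ψ (g * X t) - ψ g - t * (d₁ g + d₂ g)| ≤ 2 * ε * |t| := by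
  have hn₁ : ∀ᶠ p : G × ℝ in 𝓝 (1, 0), |d₁ (g * p.1 * X₁ p.2) - d₁ g| < ε := by
    have : Continuous fun p : G × ℝ => |d₁ (g * p.1 * X₁ p.2) - d₁ g| := by fun_prop
    exact this.tendsto' _ 0 (by simp [h₁]) (gt_mem_nhds hε)
  have hn₂ : ∀ᶠ p : G × ℝ × ℝ in 𝓝 (1, 0, 0),
      |d₂ (g * p.1 * X₁ p.2.1 * X₂ p.2.2) - d₂ g| < ε := by
    have : Continuous fun p : G × ℝ × ℝ => |d₂ (g * p.1 * X₁ p.2.1 * X₂ p.2.2) - d₂ g| := by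
      fun_prop
    exact this.tendsto' _ 0 (by simp [h₁, h₂]) (gt_mem_nhds hε)
  rw [nhds_prod_eq] at hn₁ hn₂
  rw [nhds_prod_eq] at hn₂
  obtain ⟨p, hp, q, hq, hpq⟩ := eventually_prod_iff.1 hn₁
  obtain ⟨p', hp', q', hq', hpq'⟩ := eventually_prod_iff.1 hn₂
  obtain ⟨a, ha, b, hb, hab⟩ := eventually_prod_iff.1 hq'
  obtain ⟨δ, hδ, hpow⟩ := hT.exists_pow_mem hX hX₁ hX₂ h0 h₁ h₂ (hp.and hp')
  obtain ⟨η, hη, hqab⟩ := Metric.eventually_nhds_iff.1 (hq.and (ha.and hb))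
  simp only [Real.dist_eq, sub_zero] at hqab
  have hlt : ∀ᶠ t in 𝓝 (0 : ℝ), |t| < min δ η :=
    (continuous_abs (G := ℝ)).tendsto' 0 0 abs_zero (gt_mem_nhds (lt_min hδ hη))
  filter_upwards [hlt] with t ht
  rw [lt_min_iff] at ht
  have hlim : Tendsto (fun n : ℕ =>
      |ψ (g * (X₁ (t / n) * X₂ (t / n)) ^ n) - ψ g - t * (d₁ g + d₂ g)|) atTop
      (𝓝 |ψ (g * X t) - ψ g - t * (d₁ g + d₂ g)|) :=
    (((((hψ.comp (continuous_const_mul g)).tendsto _).comp (hT.tendsto t)).sub_const _).sub_const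
      _).abs
  refine le_of_tendsto hlim ?_
  filter_upwards [eventually_ge_atTop 1] with n hn
  have hn' : (1 : ℝ) ≤ n := by exact_mod_cast hn
  set s := t / n with hs
  have hst : |s| ≤ |t| := by
    rw [hs, abs_div, Nat.abs_cast]
    exact div_le_self (abs_nonneg t) hn'
  have hns : (n : ℝ) * s = t := mul_div_cancel₀ t (by positivity)
  have htel := abs_sub_sub_nat_mul_le (u := fun k => ψ (g * (X₁ s * X₂ s) ^ k))
    (a := s * (d₁ g + d₂ g)) (b := 2 * ε * |s|) (n := n) fun k hk => by
      obtain ⟨hk₁, hk₂⟩ := hpow t ht.1 n k hk.le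
      have hsmall : ∀ r : ℝ, |r| ≤ |s| → |r| < η := fun r hr => (hr.trans hst).trans_lt ht.2
      have e₁ := hd₁.abs_sub_sub_le hm₁ h₁ (g := g * (X₁ s * X₂ s) ^ k) (c := d₁ g) (t := s)
        fun r hr => (hpq hk₁ (hqab (hsmall r hr)).1).le
      have e₂ := hd₂.abs_sub_sub_le hm₂ h₂ (g := g * (X₁ s * X₂ s) ^ k * X₁ s) (c := d₂ g)
        (t := s) fun r hr =>
          (hpq' hk₂ (hab (hqab (hsmall s le_rfl)).2.1 (hqab (hsmall r hr)).2.2)).le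
      have hsucc : g * (X₁ s * X₂ s) ^ (k + 1) = g * (X₁ s * X₂ s) ^ k * X₁ s * X₂ s := by
        simp only [pow_succ, mul_assoc]
      rw [hsucc]
      rw [abs_le] at e₁ e₂ ⊢
      constructor <;> linarith [e₁.1, e₁.2, e₂.1, e₂.2]
  have hnabs : (n : ℝ) * |s| = |t| := by rw [← hns, abs_mul, Nat.abs_cast]
  rw [← mul_assoc, hns, mul_left_comm, hnabs] at htel
  simpa using htel

lemma IsTrotterSum.tendsto_rightQuotient (hT : IsTrotterSum X X₁ X₂)
    (hX : Continuous X) (hX₁ : Continuous X₁) (hX₂ : Continuous X₂)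
    (h0 : X 0 = 1) (h₁ : X₁ 0 = 1) (h₂ : X₂ 0 = 1)
    (hm₁ : ∀ s t, X₁ (s + t) = X₁ s * X₁ t) (hm₂ : ∀ s t, X₂ (s + t) = X₂ s * X₂ t)
    (hψ : Continuous ψ) (hd₁ : HasRightDeriv ψ X₁ d₁) (hd₂ : HasRightDeriv ψ X₂ d₂)
    (hc₁ : Continuous d₁) (hc₂ : Continuous d₂) (g : G) :
    Tendsto (rightQuotient ψ X g) (𝓝[≠] 0) (𝓝 (d₁ g + d₂ g)) := by
  have hder : HasDerivAt (fun t => ψ (g * X t)) (d₁ g + d₂ g) 0 := by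
    rw [hasDerivAt_iff_isLittleO, Asymptotics.isLittleO_iff]
    intro ε hε
    filter_upwards [hT.abs_sub_sub_le hX hX₁ hX₂ h0 h₁ h₂ hm₁ hm₂ hψ hd₁ hd₂ hc₁ hc₂ g
      (half_pos hε)] with t ht
    simpa [h0, mul_div_cancel₀] using ht
  refine (hasDerivAt_iff_tendsto_slope_zero.1 hder).congr fun t => ?_
  simp only [rightQuotient, zero_add, h0, mul_one]

end LCLie

theorem mainTheorem1
    {E : Type*} [AddCommGroup E] [Module ℝ E] [TopologicalSpace E] [IsTopologicalAddGroup E]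
    [ContinuousSMul ℝ E] [LocallyConvexSpace ℝ E] [T2Space E]
    {G : Type*} [Group G] [TopologicalSpace G] [T2Space G] [ChartedSpace E G]
    (hG : LCLie.IsLieGroup E G)
    (exp : LCLie.LieAlg E G → G) (hT : LCLie.HasTrotterProperty exp)
    {V : Type*} [AddCommGroup V] [Module ℝ V] [TopologicalSpace V] [IsTopologicalAddGroup V]
    [ContinuousSMul ℝ V] [LocallyConvexSpace ℝ V] [T2Space V]
    (φ : C(G, V))
    (hex : ∀ (x : LCLie.LieAlg E G) (g : G),
      LCLie.RightDerivExistsAt φ (fun t : ℝ => exp (t • x)) g)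
    (hcont : ∀ x : LCLie.LieAlg E G,
      Continuous (LCLie.rightDeriv φ (fun t : ℝ => exp (t • x)))) :
    IsLinearMap ℝ (fun x : LCLie.LieAlg E G =>
      (⟨LCLie.rightDeriv φ (fun t : ℝ => exp (t • x)), hcont x⟩ : C(G, V))) := by
  have : ContinuousMul G := ⟨letI := LCLie.prodManifold E E G G; hG.smooth_mul.continuous⟩
  have hexp : ∀ x : LCLie.LieAlg E G, Continuous fun t : ℝ => exp (t • x) := fun x =>
    hT.exponential.smooth.continuous.comp (continuous_id.smul continuous_const)
  have hone : ∀ x : LCLie.LieAlg E G, exp ((0 : ℝ) • x) = 1 := fun x =>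
    (hT.exponential.velocity x).1
  have hd : ∀ x : LCLie.LieAlg E G, LCLie.HasRightDeriv φ (fun t : ℝ => exp (t • x))
      (LCLie.rightDeriv φ (fun t : ℝ => exp (t • x))) := fun x g => tendsto_nhds_limUnder (hex x g)
  constructor
  · intro x y
    ext g
    refine (SeparatingDual.eq_iff_forall_dual_eq (R := ℝ)).2 fun l => ?_
    have hl : ∀ z : LCLie.LieAlg E G, LCLie.HasRightDeriv (fun g => l (φ g))
        (fun t : ℝ => exp (t • z)) (fun g => l (LCLie.rightDeriv φ (fun t : ℝ => exp (t • z)) g)) :=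
      fun z g => ((l.continuous.tendsto _).comp (hd z g)).congr fun t => by
        simp [LCLie.rightQuotient]
    have hsum := (hT.trotter x y).tendsto_rightQuotient (hexp _) (hexp x) (hexp y) (hone _) (hone x)
      (hone y) (hT.exponential.map_add x) (hT.exponential.map_add y)
      (l.continuous.comp φ.continuous) (hl x) (hl y) (l.continuous.comp (hcont x))
      (l.continuous.comp (hcont y)) g
    simpa using tendsto_nhds_unique (hl (x + y) g) hsum
  · intro c x
    ext g
    refine tendsto_nhds_unique (hd (c • x) g) ?_
    obtain rfl | hc := eq_or_ne c 0
    · have h1 : exp 0 = 1 := by simpa using hone 0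
      have hq : LCLie.rightQuotient φ (fun t : ℝ => exp (t • (0 : ℝ) • x)) g = fun _ => 0 := by
        ext t
        simp [LCLie.rightQuotient, h1]
      rw [hq]
      simp
    · have hscale : Tendsto (fun t : ℝ => t * c) (𝓝[≠] 0) (𝓝[≠] 0) := by
        refine tendsto_nhdsWithin_iff.2 ⟨?_, ?_⟩
        · exact ((continuous_mul_const c).tendsto' 0 0 (zero_mul c)).mono_left nhdsWithin_le_nhds
        · filter_upwards [self_mem_nhdsWithin] with t ht using mul_ne_zero ht hc
      refine (((hd x g).comp hscale).const_smul c).congr fun t => ?_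
      simp only [LCLie.rightQuotient, Function.comp_apply, smul_smul, mul_inv_rev]
      rw [mul_inv_cancel_left₀ hc]
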